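/- Let $\mathbb{F}_q$ be a finite field of characteristic $p$ and let $H$ be a finite group with $p \mid |H|$. A principal indecomposable module of the group algebra $\mathbb{F}_qH$ is a left ideal $\mathbb{F}_qH\,e$ generated by a primitive idempotent $e$ (a nonzero idempotent that is not a sum of two nonzero orthogonal idempotents). The algebra $\mathbb{F}_qH$ is called an ECID group algebra if every principal indecomposable module of $\mathbb{F}_qH$ has $\mathbb{F}_q$-dimension at most $p$. It has finite representation type if there are, up to isomorphism, only finitely many finitely generated indecomposable left $\mathbb{F}_qH$-modules. **Theorem.** If $I$ is a principal indecomposable module of $\mathbb{F}_qH$ with $\dim_{\mathbb{F}_q} I \le p$, then $\dim_{\mathbb{F}_q} I = p$, every Sylow $p$-subgroup of $H$ is isomorphic to the cyclic group $C_p$ of order $p$, and $\mathbb{F}_qH$ has finite representation type. In particular, if $\mathbb{F}_qH$ is an ECID group algebra, then every principal indecomposable module of $\mathbb{F}_qH$ has dimension exactly $p$, every Sylow $p$-subgroup of $H$ is isomorphic to $C_p$, and $\mathbb{F}_qH$ has finite representation type. -/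

import Mathlib

universe u v w

/-- `e` is a primitive idempotent: a nonzero idempotent which is not the sum of two nonzero
orthogonal idempotents. -/
def IsPrimitiveIdempotent {A : Type u} [Ring A] (e : A) : Prop :=
  IsIdempotentElem e ∧ e ≠ 0 ∧
    ∀ f g : A, IsIdempotentElem f → IsIdempotentElem g → f * g = 0 → g * f = 0 → e = f + g →
      f = 0 ∨ g = 0

/-- A principal indecomposable module of `A`: a left ideal `A e` with `e` a primitive
idempotent. (`Ideal A` is the type of left ideals of `A`.) -/
def IsPrincipalIndecomposable {A : Type u} [Ring A] (I : Ideal A) : Prop :=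
  ∃ e : A, IsPrimitiveIdempotent e ∧ I = Ideal.span {e}

/-- An easily computable dimension (ECD) group code: a left ideal of `F[H]` that is generated by
an idempotent and has dimension at most the characteristic of `F`. -/
def IsECD (F : Type u) [Field F] (H : Type v) [Group H] (I : Ideal (MonoidAlgebra F H)) : Prop :=
  (∃ e : MonoidAlgebra F H, IsIdempotentElem e ∧ I = Ideal.span {e}) ∧
    Module.finrank F I ≤ ringChar F

/-- `F[H]` is an easily computable indecomposable dimension (ECID) group algebra: all its
principal indecomposable modules are ECD. -/
def IsECID (F : Type u) [Field F] (H : Type v) [Group H] : Prop :=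
  ∀ I : Ideal (MonoidAlgebra F H), IsPrincipalIndecomposable I → IsECD F H I

/-- A nonzero module which is not the direct sum of two nonzero submodules. -/
def IsIndecomposableModule (A : Type u) [Ring A] (M : Type v) [AddCommGroup M] [Module A M] :
    Prop :=
  Nontrivial M ∧ ∀ M₁ M₂ : Submodule A M, IsCompl M₁ M₂ → M₁ = ⊥ ∨ M₂ = ⊥

/-- Finite representation type: up to isomorphism there are only finitely many finitely generated
indecomposable left `A`-modules (with underlying type in the universe `w`). -/
def HasFiniteRepresentationType (A : Type u) [Ring A] : Prop :=
  ∃ S : Set (ModuleCat.{w} A), S.Finite ∧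
    ∀ (M : Type w) [AddCommGroup M] [Module A M], Module.Finite A M →
      IsIndecomposableModule A M → ∃ N ∈ S, Nonempty (M ≃ₗ[A] N)

open MonoidAlgebra

/-! Let A = F[H], P a Sylow p-subgroup, N the sum of its elements. A p-group fixes a nonzero vector
x in Ae, and fixed vectors have the form x = Nz. Since xe = x, the map b ↦ bze from F[P] to Ae is
injective: a nonzero kernel would contain a nonzero fixed vector, that is, a multiple of N, but Nze
= x ≠ 0. Hence |P| ≤ dim Ae (`IsPGroup.card_le_finrank_span_idempotent`). With dim Ae ≤ p and p ∣
|H|, both numbers equal p.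

Finite type follows from P being cyclic. Restricted to P, an A-module M is a torsion F[X]-module, so
the identity is a sum of projections onto cyclic pieces. Their relative traces to H sum to [H:P],
which is prime to p and so invertible. If M is indecomposable, its endomorphism ring is local, so
one trace is bijective, and its image lies in a single Ax. Thus M is cyclic, and a finite ring has
only finitely many cyclic modules up to isomorphism. -/

/-- A `p`-group acting additively on a nontrivial finite group of exponent `p` fixes a nonzero
vector. -/
theorem IsPGroup.exists_ne_zero_smul_eq {p : ℕ} [Fact p.Prime] {Q : Type*} [Group Q]
    (hQ : IsPGroup p Q) {A V : Type*} [Ring A] [AddCommGroup V] [Module A V] [Finite V]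
    (s : Q →* A) (hV : ∀ v : V, p • v = 0) (W : AddSubgroup V)
    (hW : ∀ q, ∀ w ∈ W, s q • w ∈ W) (hne : W ≠ ⊥) :
    ∃ w ∈ W, w ≠ 0 ∧ ∀ q, s q • w = w := by
  let act : MulAction Q W :=
    { smul := fun q w => ⟨s q • (w : V), hW q w w.2⟩
      one_smul := fun w => Subtype.ext (by
        change s 1 • (w : V) = w
        simp)
      mul_smul := fun a b w => Subtype.ext (by
        change s (a * b) • (w : V) = s a • s b • (w : V)
        rw [map_mul, mul_smul]) }
  obtain ⟨w, hw⟩ := W.ne_bot_iff_exists_ne_zero.1 hne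
  have hdvd : p ∣ Nat.card W := by
    have h : addOrderOf w = p := addOrderOf_eq_prime (Subtype.ext (by simpa using hV w)) hw
    exact h ▸ addOrderOf_dvd_natCard w
  obtain ⟨b, hb, hb0⟩ := hQ.exists_fixed_point_of_prime_dvd_card_of_fixed_point W hdvd
    (a := (0 : W)) (fun q => Subtype.ext (smul_zero (s q)))
  exact ⟨b, b.2, fun h => hb0 (Subtype.ext h.symm), fun q => congrArg Subtype.val (hb q)⟩

/-- An element of `F[H]` fixed under left multiplication by a subgroup `Q` is a left multiple of
the sum of the elements of `Q`. -/
theorem MonoidAlgebra.exists_sum_of_mul_eq {F H : Type*} [Field F] [Group H] (Q : Subgroup H)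
    [Fintype Q] (x : MonoidAlgebra F H) (hx : ∀ q : Q, of F H q * x = x) :
    ∃ z, (∑ q : Q, of F H q) * z = x := by
  classical
  let r : H → H := fun h => ((h : H ⧸ Q).out)
  have hr : ∀ h, ∃ q : Q, r h = h * q := fun h => by
    obtain ⟨q, hq⟩ := QuotientGroup.mk_out_eq_mul Q h
    exact ⟨q, hq⟩
  have hrq : ∀ (h : H) (q : Q), r (h * q) = r h := fun h q => by
    simp [r]
  -- The witness restricts x to a transversal of the right cosets Qh. The representatives `r` belong
  -- to left cosets, hence the inverses.
  refine ⟨ofCoeff (x.coeff.filter fun h => r h⁻¹ = h⁻¹), ?_⟩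
  have hx' : ∀ (q : Q) (h : H), x.coeff ((q : H)⁻¹ * h) = x.coeff h := fun q h => by
    conv_rhs => rw [← hx q]
    simp [of_apply, coeff_single_mul_apply]
  ext h
  obtain ⟨q₀, hq₀⟩ := hr h⁻¹
  rw [Finset.sum_mul, coeff_sum, Finset.sum_apply', Finset.sum_eq_single q₀]
  · rw [of_apply, coeff_single_mul_apply, one_mul, Finsupp.filter_apply_pos, hx']
    rw [mul_inv_rev, inv_inv, hrq, hq₀]
  · intro q _ hq
    rw [of_apply, coeff_single_mul_apply, one_mul, Finsupp.filter_apply_neg]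
    rw [mul_inv_rev, inv_inv, hrq, hq₀, mul_right_inj]
    exact fun h => hq (Subtype.ext h.symm)
  · simp

theorem MonoidAlgebra.nsmul_char_eq_zero {F : Type*} [Field F] (p : ℕ) [CharP F p]
    {H : Type*} [Group H] {M : Type*} [AddCommGroup M] [Module (MonoidAlgebra F H) M] (m : M) :
    p • m = 0 := by
  have h : ((p : ℕ) : MonoidAlgebra F H) = 0 := by
    rw [← map_natCast (algebraMap F (MonoidAlgebra F H)), CharP.cast_eq_zero, map_zero]
  rw [← Nat.cast_smul_eq_nsmul (MonoidAlgebra F H), h, zero_smul]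

instance MonoidAlgebra.finite_of_finite (F H : Type*) [Field F] [Finite F] [Finite H] :
    Finite (MonoidAlgebra F H) :=
  Finite.of_injective (fun a => (a.coeff : H → F)) fun _ _ h =>
    coeff_injective (DFunLike.coe_injective h)

/-- The dimension of a nonzero projective left ideal of `F[H]` is at least the order of any
`p`-subgroup. -/
theorem IsPGroup.card_le_finrank_span_idempotent {F : Type*} [Field F] [Finite F] {p : ℕ}
    [CharP F p] [Fact p.Prime] {H : Type*} [Group H] [Finite H] {Q : Subgroup H}
    (hQ : IsPGroup p Q) {e : MonoidAlgebra F H} (he : IsIdempotentElem e) (he0 : e ≠ 0) :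
    Nat.card Q ≤ Module.finrank F (Ideal.span {e} : Ideal (MonoidAlgebra F H)) := by
  classical
  have := Fintype.ofFinite Q
  set I : Ideal (MonoidAlgebra F H) := Ideal.span {e} with hI
  have hIne : I.toAddSubgroup ≠ ⊥ := fun h => he0 <| by
    have : e ∈ I.toAddSubgroup := Ideal.mem_span_singleton_self e
    rwa [h, AddSubgroup.mem_bot] at this
  obtain ⟨x, hxI, hx0, hx⟩ := hQ.exists_ne_zero_smul_eq ((of F H).comp Q.subtype)
    (nsmul_char_eq_zero (F := F) (H := H) p) I.toAddSubgroup (fun q w hw => I.smul_mem _ hw) hIne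
  obtain ⟨z, hz⟩ := exists_sum_of_mul_eq Q x hx
  obtain ⟨a, rfl⟩ : ∃ a, a * e = x := Ideal.mem_span_singleton'.1 hxI
  let ψ : MonoidAlgebra F Q →ₐ[F] MonoidAlgebra F H := mapDomainAlgHom F F Q.subtype
  have hψ : ∀ q : Q, ψ (of F Q q) = of F H q := fun q => by simp [ψ, of_apply]
  let f : MonoidAlgebra F Q →ₗ[F] I :=
    ((LinearMap.mulRight F (z * e)).comp ψ.toLinearMap).codRestrict (I.restrictScalars F)
      (fun b => by
        change ψ b * (z * e) ∈ I
        rw [← mul_assoc]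
        exact I.mul_mem_left _ (Ideal.mem_span_singleton_self e))
  have hf : ∀ b, (f b : MonoidAlgebra F H) = ψ b * (z * e) := fun b => rfl
  have hinj : Function.Injective f := by
    rw [← LinearMap.ker_eq_bot]
    by_contra hker
    -- The kernel is stable under Q, so it contains a nonzero fixed b; a fixed b has constant
    -- coefficients.
    obtain ⟨b, hbK, hb0, hb⟩ := hQ.exists_ne_zero_smul_eq (of F Q)
      (nsmul_char_eq_zero (F := F) (H := Q) p) (LinearMap.ker f).toAddSubgroup
      (fun q w hw => by
        have hw : f w = 0 := hw
        change f (of F Q q * w) = 0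
        apply Subtype.ext
        rw [hf, map_mul, mul_assoc, ← hf, hw]
        simp)
      (fun h => hker (Submodule.toAddSubgroup_injective h))
    have hbq : ∀ q, b.coeff q = b.coeff 1 := fun q => by
      conv_lhs => rw [← hb q]
      simp [of_apply, coeff_single_mul_apply]
    have hbsum : b = b.coeff 1 • ∑ q : Q, of F Q q := by
      ext q
      simp [of_apply, coeff_sum, Finsupp.single_apply, hbq q]
    have h0 : (f b : MonoidAlgebra F H) = 0 := congrArg Subtype.val (show f b = 0 from hbK)
    rw [hf, hbsum, map_smul, map_sum, smul_mul_assoc] at h0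
    simp only [hψ] at h0
    rw [← mul_assoc, hz, mul_assoc, he.eq] at h0
    rcases smul_eq_zero.1 h0 with h | h
    · exact hb0 (by rw [hbsum, h, zero_smul])
    · exact hx0 h
  calc Nat.card Q = Module.finrank F (MonoidAlgebra F Q) := by
        rw [(MonoidAlgebra.coeffLinearEquiv (S := F) (R := F) (M := Q)).finrank_eq, Module.finrank_finsupp_self,
          Nat.card_eq_fintype_card]
    _ ≤ _ := LinearMap.finrank_le_finrank_of_injective hinj

/-! ### Primitive idempotents, Fitting's lemma, torsion modules -/

/-- A nontrivial finite ring has a primitive idempotent. -/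
theorem exists_isPrimitiveIdempotent (A : Type u) [Ring A] [Finite A] [Nontrivial A] :
    ∃ e : A, IsPrimitiveIdempotent e := by
  obtain ⟨e, ⟨he, he0⟩, hmin⟩ := Set.exists_min_image {e : A | IsIdempotentElem e ∧ e ≠ 0}
    (fun e => ((Ideal.span {e} : Ideal A) : Set A).ncard) (Set.toFinite _)
    ⟨1, IsIdempotentElem.one, one_ne_zero⟩
  refine ⟨e, he, he0, fun f g hf hg hfg hgf hefg => ?_⟩
  by_contra! h
  have hfe : f * e = f := by rw [hefg, mul_add, hf.eq, hfg, add_zero]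
  -- A proper summand f of e generates a strictly smaller left ideal, since right multiplication by
  -- g kills Af but sends e to g ≠ 0.
  have hlt : (Ideal.span {f} : Ideal A) < Ideal.span {e} := by
    refine lt_of_le_of_ne ?_ fun heq => h.2 ?_
    · rw [Ideal.span_singleton_le_iff_mem, Ideal.mem_span_singleton']
      exact ⟨f, hfe⟩
    · have : e ∈ (Ideal.span {f} : Ideal A) := heq ▸ Ideal.mem_span_singleton_self e
      obtain ⟨a, ha⟩ := Ideal.mem_span_singleton'.1 this
      have : e * g = 0 := by rw [← ha, mul_assoc, hfg, mul_zero]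
      rwa [hefg, add_mul, hfg, hg.eq, zero_add] at this
  have := hmin f ⟨hf, h.1⟩
  exact absurd this (not_le.2 (Set.ncard_lt_ncard (SetLike.coe_ssubset_coe.2 hlt) (Set.toFinite _)))

/-- Fitting's lemma: the endomorphism ring of an indecomposable module of finite length is
local. -/
theorem IsIndecomposableModule.isLocalRing_end {A : Type u} [Ring A] {M : Type w}
    [AddCommGroup M] [Module A M] [IsArtinian A M] [IsNoetherian A M]
    (hM : IsIndecomposableModule A M) : IsLocalRing (Module.End A M) := by
  have := hM.1
  refine ⟨fun {f g} hfg => ?_⟩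
  -- Positivity of n lets invertibility pass from `f ^ n` to `f`.
  obtain ⟨n, hn, hn0⟩ := (f.eventually_isCompl_ker_pow_range_pow.and
    (Filter.eventually_gt_atTop 0)).exists
  rcases hM.2 _ _ hn with h | h
  · left
    have hinj : Function.Injective (f ^ n) := LinearMap.ker_eq_bot.1 h
    have hsurj : Function.Surjective (f ^ n) := IsArtinian.surjective_of_injective_endomorphism _ hinj
    exact (isUnit_pow_iff hn0.ne').1 ((Module.End.isUnit_iff _).2 ⟨hinj, hsurj⟩)
  · right
    have hnil : IsNilpotent f := ⟨n, LinearMap.range_eq_bot.1 h⟩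
    rw [← eq_sub_iff_add_eq'] at hfg
    exact hfg ▸ hnil.isUnit_one_sub

/-- The identity of a finitely generated torsion module over a principal ideal domain is a finite
sum of endomorphisms with values in cyclic submodules. -/
theorem Module.exists_sum_end_eq_one_of_isTorsion {R : Type u} [CommRing R] [IsDomain R]
    [IsPrincipalIdealRing R] {M : Type*} [AddCommGroup M] [Module R M] [Module.Finite R M]
    (hM : Module.IsTorsion R M) :
    ∃ (ι : Type u) (_ : Fintype ι) (φ : ι → Module.End R M) (x : ι → M),
      ∑ i, φ i = 1 ∧ ∀ i m, φ i m ∈ Submodule.span R {x i} := by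
  classical
  obtain ⟨ι, _, q, -, n, ⟨e⟩⟩ := Module.equiv_directSum_of_isTorsion hM
  refine ⟨ι, inferInstance, fun i => e.symm.toLinearMap ∘ₗ DirectSum.lof R ι _ i ∘ₗ
    DirectSum.component R ι _ i ∘ₗ e.toLinearMap,
    fun i => e.symm (DirectSum.lof R ι _ i 1), ?_, fun i m => ?_⟩
  · ext m
    apply e.injective
    simp only [LinearMap.sum_apply, LinearMap.comp_apply, LinearEquiv.coe_coe, map_sum,
      LinearEquiv.apply_symm_apply, Module.End.one_apply]
    exact DirectSum.sum_univ_of (e m)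
  · obtain ⟨r, hr⟩ := Submodule.Quotient.mk_surjective _ (DirectSum.component R ι _ i (e m))
    rw [Submodule.mem_span_singleton]
    refine ⟨r, ?_⟩
    simp only [LinearMap.comp_apply, LinearEquiv.coe_coe]
    rw [← hr, ← map_smul, ← map_smul]
    congr 2
    exact (Submodule.Quotient.mk_smul _ r 1).symm.trans (by rw [smul_eq_mul, mul_one])

/-! ### Relative traces and cyclicity of indecomposables -/

variable {F : Type u} [Field F] {H : Type v} [Group H] {M : Type w} [AddCommGroup M]
  [Module (MonoidAlgebra F H) M]

/-- Let X act on M as g. As g has finite order n, X ^ n - 1 kills M, and the structure theorem over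
F[X] applies. F[X]-linearity of the pieces gives commutation with scalars and with powers of g. -/
theorem MonoidAlgebra.exists_sum_eq_one_commute [Finite H]
    [Module.Finite (MonoidAlgebra F H) M] (g : H) :
    ∃ (ι : Type u) (_ : Fintype ι) (φ : ι → M →+ M) (x : ι → M), (∀ m, ∑ i, φ i m = m) ∧
      (∀ i m, φ i m ∈ Submodule.span (MonoidAlgebra F H) {x i}) ∧
      (∀ i (c : F) m, φ i (single (1 : H) c • m) = single (1 : H) c • φ i m) ∧
      ∀ i m, ∀ q ∈ Subgroup.zpowers g, φ i (of F H q • m) = of F H q • φ i m := by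
  let α : Polynomial F →ₐ[F] MonoidAlgebra F H := Polynomial.aeval (of F H g)
  let : Module (Polynomial F) M := Module.compHom M α.toRingHom
  have hsmul : ∀ (f : Polynomial F) (m : M), f • m = α f • m := fun _ _ => rfl
  let : Module F M := Module.compHom M (algebraMap F (MonoidAlgebra F H))
  have hsmulF : ∀ (c : F) (m : M), c • m = single (1 : H) c • m := fun _ _ => rfl
  have : IsScalarTower F (MonoidAlgebra F H) M :=
    ⟨fun c a m => by rw [Algebra.smul_def, mul_smul]; rfl⟩
  have : IsScalarTower F (Polynomial F) M :=
    ⟨fun c a m => by rw [hsmul, map_smul, smul_assoc, hsmul]⟩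
  have : Module.Finite F (MonoidAlgebra F H) :=
    Module.Finite.equiv (MonoidAlgebra.coeffLinearEquiv (S := F) (R := F) (M := H)).symm
  have : Module.Finite F M := Module.Finite.trans (MonoidAlgebra F H) M
  have : Module.Finite (Polynomial F) M := Module.Finite.of_restrictScalars_finite F _ M
  have htors : Module.IsTorsion (Polynomial F) M := fun {m} => by
    have hpos : 0 < orderOf g := orderOf_pos g
    refine ⟨⟨Polynomial.X ^ orderOf g - 1, mem_nonZeroDivisors_of_ne_zero
      (Polynomial.X_pow_sub_C_ne_zero hpos 1)⟩, ?_⟩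
    change (Polynomial.X ^ orderOf g - 1 : Polynomial F) • m = 0
    rw [hsmul, map_sub, map_pow, Polynomial.aeval_X, ← map_pow, pow_orderOf_eq_one, map_one,
      map_one, sub_self, zero_smul]
  obtain ⟨ι, hι, φ, x, hsum, hx⟩ := Module.exists_sum_end_eq_one_of_isTorsion htors
  have hpow : ∀ i m (k : ℕ), φ i (of F H (g ^ k) • m) = of F H (g ^ k) • φ i m := by
    intro i m k
    have h := (φ i).map_smul (Polynomial.X ^ k) m
    rwa [hsmul, hsmul, map_pow, Polynomial.aeval_X, ← map_pow] at h
  refine ⟨ι, hι, fun i => (φ i).toAddMonoidHom, x, fun m => ?_, fun i m => ?_, fun i c m => ?_,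
    fun i m q hq => ?_⟩
  · simpa using LinearMap.congr_fun hsum m
  · obtain ⟨r, hr⟩ := Submodule.mem_span_singleton.1 (hx i m)
    exact Submodule.mem_span_singleton.2 ⟨α r, hr⟩
  · have h := (φ i).map_smul (Polynomial.C c) m
    rwa [hsmul, hsmul, Polynomial.aeval_C] at h
  · rw [← mem_powers_iff_mem_zpowers] at hq
    obtain ⟨k, rfl⟩ := hq
    exact hpow i m k

/-- The relative trace from a subgroup `Q` to `H` of an endomorphism that commutes with `Q`. -/
theorem MonoidAlgebra.exists_relative_trace (Q : Subgroup H) [Fintype (H ⧸ Q)]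
    (φ : M →+ M) (hF : ∀ (c : F) m, φ (single (1 : H) c • m) = single (1 : H) c • φ m)
    (hQ : ∀ m, ∀ q ∈ Q, φ (of F H q • m) = of F H q • φ m) :
    ∃ T : Module.End (MonoidAlgebra F H) M,
      ∀ m, T m = ∑ c : H ⧸ Q, of F H c.out • φ (of F H c.out⁻¹ • m) := by
  let t : H → M → M := fun h m => of F H h • φ (of F H h⁻¹ • m)
  -- The conjugate of φ by h depends only on the coset hQ, so the trace is independent of
  -- representatives.
  have ht : ∀ h q, q ∈ Q → t (h * q) = t h := fun h q hq => by
    funext m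
    simp only [t]
    rw [mul_inv_rev, map_mul, map_mul, mul_smul, mul_smul, hQ _ _ (inv_mem hq), smul_smul (of F H q),
      ← map_mul, mul_inv_cancel, map_one, one_smul]
  have hout : ∀ h : H, t ((h : H ⧸ Q).out) = t h := fun h => by
    obtain ⟨q, hq⟩ := QuotientGroup.mk_out_eq_mul Q h
    rw [hq, ht _ _ q.2]
  have hcomm : ∀ (c : F) (h : H), Commute (single 1 c : MonoidAlgebra F H) (of F H h) :=
    fun c h => by simp [Commute, SemiconjBy, of_apply, single_mul_single]
  have hsingle : ∀ (h : H) (c : F), (single h c : MonoidAlgebra F H) = single 1 c * of F H h :=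
    fun c h => by simp [of_apply, single_mul_single]
  let T₀ : M →+ M := ∑ c : H ⧸ Q, ((DistribSMul.toAddMonoidHom M (of F H c.out)).comp φ).comp
    (DistribSMul.toAddMonoidHom M (of F H c.out⁻¹))
  have hT₀ : ∀ m, T₀ m = ∑ c : H ⧸ Q, t c.out m := fun m => by
    simp [T₀, t, AddMonoidHom.finsetSum_apply]
  have hTF : ∀ (c : F) m, T₀ (single (1 : H) c • m) = single (1 : H) c • T₀ m := fun c m => by
    rw [hT₀, hT₀, Finset.smul_sum]
    refine Finset.sum_congr rfl fun d _ => ?_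
    simp only [t]
    rw [smul_smul (of F H _) (single _ _), ← (hcomm _ _).eq, mul_smul, hF, smul_smul, ← (hcomm _ _).eq, mul_smul]
  have hTH : ∀ (h : H) m, T₀ (of F H h • m) = of F H h • T₀ m := fun h m => by
    rw [hT₀, hT₀, Finset.smul_sum, ← Equiv.sum_comp (MulAction.toPerm h)]
    refine Finset.sum_congr rfl fun d _ => ?_
    have hd : (MulAction.toPerm h d : H ⧸ Q) = ((h * d.out : H) : H ⧸ Q) := by
      conv_lhs => rw [← d.out_eq]
      rfl
    rw [hd, hout]
    simp only [t]
    rw [mul_inv_rev, smul_smul, ← map_mul, inv_mul_cancel_right, map_mul, mul_smul]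
  refine ⟨{ T₀ with map_smul' := fun a m => ?_ }, fun m => hT₀ m⟩
  change T₀ (a • m) = a • T₀ m
  induction a using MonoidAlgebra.induction_linear with
  | zero => simp
  | add a b ha hb => rw [add_smul, add_smul, map_add, ha, hb]
  | single h c => rw [hsingle, mul_smul, mul_smul, hTF, hTH]

/-- If a Sylow `p`-subgroup of `H` is cyclic, every finitely generated indecomposable
`F[H]`-module is cyclic. -/
theorem IsIndecomposableModule.exists_span_singleton_eq_top {p : ℕ} [CharP F p] [Fact p.Prime]
    [Finite H] [Module.Finite (MonoidAlgebra F H) M] (P : Sylow p H) [IsCyclic P]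
    (hM : IsIndecomposableModule (MonoidAlgebra F H) M) :
    ∃ x : M, Submodule.span (MonoidAlgebra F H) {x} = ⊤ := by
  classical
  have := Fintype.ofFinite (H ⧸ (P : Subgroup H))
  have : Module.Finite F (MonoidAlgebra F H) :=
    Module.Finite.equiv (MonoidAlgebra.coeffLinearEquiv (S := F) (R := F) (M := H)).symm
  have : IsArtinianRing (MonoidAlgebra F H) := IsArtinianRing.of_finite F _
  have := hM.isLocalRing_end
  obtain ⟨g, hg⟩ := (Subgroup.isCyclic_iff_exists_zpowers_eq_top (P : Subgroup H)).1 ‹_›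
  obtain ⟨ι, _, φ, x, hsum, hx, hF, hg'⟩ := exists_sum_eq_one_commute (F := F) (M := M) g
  rw [hg] at hg'
  choose T hT using fun i => exists_relative_trace (P : Subgroup H) (φ i) (hF i) (hg' i)
  have hTsum : ∑ i, T i = ((P : Subgroup H).index : Module.End (MonoidAlgebra F H) M) := by
    ext m
    simp only [LinearMap.sum_apply, hT]
    rw [Finset.sum_comm]
    simp only [← Finset.smul_sum, hsum, smul_smul, ← map_mul, mul_inv_cancel, map_one, one_smul,
      Finset.sum_const, Finset.card_univ, Module.End.natCast_apply]
    rw [Subgroup.index, Nat.card_eq_fintype_card]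
  have hunit : IsUnit (∑ i, T i) := by
    rw [hTsum]
    -- A Bézout relation between the index and p, read where p = 0, yields an inverse of the index.
    have hcop : IsCoprime ((P : Subgroup H).index : ℤ) (p : ℤ) :=
      Nat.isCoprime_iff_coprime.2
        (((Nat.Prime.coprime_iff_not_dvd Fact.out).2 P.not_dvd_index).symm)
    obtain ⟨a, b, hab⟩ := hcop
    have hp0 : ((p : ℕ) : Module.End (MonoidAlgebra F H) M) = 0 := by
      ext m
      have h : ((p : ℕ) : MonoidAlgebra F H) = 0 := by
        rw [← map_natCast (algebraMap F (MonoidAlgebra F H)), CharP.cast_eq_zero, map_zero]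
      rw [Module.End.natCast_apply, ← Nat.cast_smul_eq_nsmul (MonoidAlgebra F H), h, zero_smul]
      rfl
    have hab' := congrArg (Int.cast : ℤ → Module.End (MonoidAlgebra F H) M) hab
    push_cast at hab'
    rw [hp0, mul_zero, add_zero] at hab'
    exact ⟨⟨_, _, (Nat.cast_commute _ _).eq.trans hab', hab'⟩, rfl⟩
  obtain ⟨i, -, hi⟩ := IsLocalRing.exists_of_isUnit_sum hunit
  refine ⟨x i, eq_top_iff.2 fun m _ => ?_⟩
  obtain ⟨m, rfl⟩ := ((Module.End.isUnit_iff _).1 hi).2 m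
  rw [hT]
  exact Submodule.sum_mem _ fun c _ => Submodule.smul_mem _ _ (hx i _)

/-- A finite ring whose finitely generated indecomposable modules are cyclic has finite
representation type. -/
theorem HasFiniteRepresentationType.of_cyclic {A : Type u} [Ring A] [Finite A]
    (h : ∀ (M : Type w) [AddCommGroup M] [Module A M], Module.Finite A M →
      IsIndecomposableModule A M → ∃ x : M, Submodule.span A {x} = ⊤) :
    HasFiniteRepresentationType.{u, w} A := by
  -- The quotients live in the universe of A; being finite, they have copies in universe `w`.
  have hsmall : ∀ K : Ideal A, Small.{w} (A ⧸ K) := fun K =>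
    have : Finite (A ⧸ K) := Finite.of_surjective _ (Submodule.mkQ_surjective K)
    inferInstance
  refine ⟨Set.range fun K : Ideal A => ModuleCat.of A (Shrink.{w} (A ⧸ K)), ?_, ?_⟩
  · have : Finite (Ideal A) := Finite.of_injective (fun K : Ideal A => (K : Set A))
      SetLike.coe_injective
    exact Set.finite_range _
  · intro M _ _ hfin hM
    obtain ⟨x, hx⟩ := h M hfin hM
    refine ⟨_, ⟨LinearMap.ker (LinearMap.toSpanSingleton A M x), rfl⟩, ⟨?_⟩⟩
    exact ((Shrink.linearEquiv A _).trans (LinearMap.quotKerEquivOfSurjective _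
      (LinearMap.range_eq_top.1 (by rw [LinearMap.range_toSpanSingleton, hx])))).symm

theorem finrank_eq_and_sylow_and_hasFiniteRepresentationType (F : Type u) [Field F] [Finite F]
    (p : ℕ) [CharP F p] (H : Type v) [Group H] [Finite H] (hp : p ∣ Nat.card H)
    (I : Ideal (MonoidAlgebra F H)) (hI : IsPrincipalIndecomposable I)
    (hle : Module.finrank F I ≤ p) :
    Module.finrank F I = p ∧
      (∀ P : Sylow p H, Nonempty (P ≃* Multiplicative (ZMod p))) ∧
      HasFiniteRepresentationType.{max u v, w} (MonoidAlgebra F H) := by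
  have hprime : Fact p.Prime := ⟨CharP.char_is_prime F p⟩
  obtain ⟨e, ⟨he, he0, -⟩, rfl⟩ := hI
  have hcard_le : ∀ P : Sylow p H, Nat.card P ≤ Module.finrank F (Ideal.span {e} : Ideal _) :=
    fun P => P.isPGroup'.card_le_finrank_span_idempotent he he0
  have hcard : ∀ P : Sylow p H, Nat.card P = p := fun P =>
    le_antisymm ((hcard_le P).trans hle) (Nat.le_of_dvd Nat.card_pos (P.dvd_card_of_dvd_card hp))
  have hcyc : ∀ P : Sylow p H, IsCyclic P := fun P => isCyclic_of_prime_card (hcard P)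
  obtain ⟨P⟩ : Nonempty (Sylow p H) := inferInstance
  refine ⟨le_antisymm hle (hcard P ▸ hcard_le P), fun Q => ?_, ?_⟩
  · exact ⟨mulEquivOfPrimeCardEq (p := p) (hcard Q) (by simp)⟩
  · have := hcyc P
    exact .of_cyclic fun M _ _ _ hM => hM.exists_span_singleton_eq_top P

theorem mainTheorem5 (F : Type u) [Field F] [Finite F] (p : ℕ) [CharP F p]
    (H : Type v) [Group H] [Finite H] (hp : p ∣ Nat.card H) :
    (∀ I : Ideal (MonoidAlgebra F H), IsPrincipalIndecomposable I → Module.finrank F I ≤ p →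
      Module.finrank F I = p ∧
      (∀ P : Sylow p H, Nonempty (P ≃* Multiplicative (ZMod p))) ∧
      HasFiniteRepresentationType.{max u v, w} (MonoidAlgebra F H)) ∧
    (IsECID F H →
      (∀ I : Ideal (MonoidAlgebra F H), IsPrincipalIndecomposable I →
        Module.finrank F I = p) ∧
      (∀ P : Sylow p H, Nonempty (P ≃* Multiplicative (ZMod p))) ∧
      HasFiniteRepresentationType.{max u v, w} (MonoidAlgebra F H)) := by
  have key := finrank_eq_and_sylow_and_hasFiniteRepresentationType.{u, v, w} F p H hp
  refine ⟨key, fun h => ?_⟩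
  have hle : ∀ I : Ideal (MonoidAlgebra F H), IsPrincipalIndecomposable I →
      Module.finrank F I ≤ p := fun I hI => ringChar.eq F p ▸ (h I hI).2
  -- The ECID hypothesis is universal, so some principal indecomposable module must exist before it
  -- says anything about H.
  obtain ⟨e, he⟩ := exists_isPrimitiveIdempotent (MonoidAlgebra F H)
  have hI : IsPrincipalIndecomposable (Ideal.span {e}) := ⟨e, he, rfl⟩
  exact ⟨fun I hI => (key I hI (hle I hI)).1, (key _ hI (hle _ hI)).2⟩
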